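/- Let $q$ be a power of a prime $p$, let $n$ be a positive integer with $\gcd(n,q)=1$, and let $m=\mathrm{ord}_n(q)$ be the multiplicative order of $q$ modulo $n$. Suppose that $q^{\lfloor m/2\rfloor}<n\le q^m-1$, and let $\delta$ be an integer with $$2\le\delta\le\delta_{\max}=\frac{n}{q^m-1}\bigl(q^{\lceil m/2\rceil}-1-(q-2)[m\text{ odd}]\bigr),$$ where $[m\text{ odd}]$ is $1$ if $m$ is odd and $0$ otherwise. Then for every integer $r$ with $0\le r<n-2m\lceil(\delta-1)(1-1/q)\rceil$ there exists a subsystem BCH code with parameters $$[[\,n,\;n-2m\lceil(\delta-1)(1-1/q)\rceil-r,\;r,\;\ge\delta\,]]_q .$$ Here the errors are the operators $X(a)Z(b)$, $a,b\in\mathbf F_q^n$, on $\mathbb C^{q^n}=(\mathbb C^q)^{\otimes n}$ with orthonormal basis $\{|x\rangle : x\in\mathbf F_q^n\}$, where $X(a)|x\rangle=|x+a\rangle$ and $Z(b)|x\rangle=e^{2\pi i\,\mathrm{tr}(b\cdot x)/p}|x\rangle$ with $\mathrm{tr}$ the trace from $\mathbf F_q$ to $\mathbf F_p$. The weight of $X(a)Z(b)$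 is the number of $i$ with $(a_i,b_i)\ne(0,0)$. An $[[n,k,r,d]]_q$ subsystem code is a subspace $Q\subseteq\mathbb C^{q^n}$ together with a decomposition $Q=A\otimes B$ as a tensor product of Hilbert spaces, $\dim A=q^k$, $\dim B=q^r$, that detects on $A$ every error $E$ of weight less than $d$: $P_QE|_Q=1_A\otimes G_E$ for some operator $G_E$ on $B$, where $P_Q$ is the orthogonal projection onto $Q$. The notation $\ge\delta$ means that $d\ge\delta$ for some admissible $d$. It is a subsystem BCH code (of designed distance $\delta$) if, for some primitive $n$-th root of unity $\alpha$ in an extension of $\mathbf F_q$, the narrow-sense BCH code $$C=\Bigl\{c\in\mathbf F_q^n : \sum_{j=0}^{n-1}c_j\alpha^{ij}=0\text{ for }1\le i\le\delta-1\Bigr\}$$ contains its Euclidean dual $C^\perp$, and $Q$ is the stabilizer code obtained from $C$, that is, the space of all $\psi$ with $X(a)Z(b)\psi=\psi$ for all $a,b\in C^\perp$. -/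

import Mathlib

open scoped TensorProduct

noncomputable section

namespace SubsystemBCH

/-! ### Classical codes -/

section Classical

variable {F : Type*} [Field F]

/-- The Euclidean dual `C^⊥` of a linear code `C ⊆ F^n`. -/
def euclideanDual {n : ℕ} (C : Submodule F (Fin n → F)) : Submodule F (Fin n → F) where
  carrier := {x | ∀ y ∈ C, x ⬝ᵥ y = 0}
  add_mem' := by
    intro x x' hx hx' y hy
    rw [add_dotProduct, hx y hy, hx' y hy, add_zero]
  zero_mem' := by
    intro y _
    exact zero_dotProduct y
  smul_mem' := by
    intro c x hx y hy
    rw [smul_dotProduct, hx y hy, smul_zero]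

/-- The narrow-sense BCH code over `F` of length `n` and designed distance `δ` with respect to `α`
(to be used for a primitive `n`-th root of unity `α`): all words `c` whose polynomial
`c(x) = ∑ j, c_j x^j` satisfies `c(α) = c(α^2) = ⋯ = c(α^(δ-1)) = 0`. -/
def bchCode (n δ : ℕ) (α : AlgebraicClosure F) : Submodule F (Fin n → F) where
  carrier := {c | ∀ i : ℕ, 1 ≤ i → i < δ →
    ∑ j : Fin n, algebraMap F (AlgebraicClosure F) (c j) * (α ^ i) ^ (j : ℕ) = 0}
  add_mem' := by
    intro c c' hc hc' i h1 h2
    simp only [Pi.add_apply, map_add, add_mul, Finset.sum_add_distrib]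
    rw [hc i h1 h2, hc' i h1 h2, add_zero]
  zero_mem' := by
    intro i _ _
    simp
  smul_mem' := by
    intro a c hc i h1 h2
    simp only [Pi.smul_apply, smul_eq_mul, map_mul, mul_assoc]
    rw [← Finset.mul_sum, hc i h1 h2, mul_zero]

end Classical

/-! ### Quantum codes -/

section Quantum

variable (p : ℕ) [Fact p.Prime] {F : Type*} [Field F] [Fintype F] [Algebra (ZMod p) F] {n : ℕ}

/-- The Hilbert space `(ℂ^q)^{⊗ n} = ℂ^{q^n}` of `n` qudits; its orthonormal basis vectors `|x⟩`
are labelled by `x ∈ F^n`. -/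
abbrev Qudits (F : Type*) [Fintype F] (n : ℕ) : Type _ := EuclideanSpace ℂ (Fin n → F)

/-- The operator `X(a) = X(a_1) ⊗ ⋯ ⊗ X(a_n)`, that is, `X(a)|x⟩ = |x + a⟩`. -/
def opX (a : Fin n → F) : Qudits F n →ₗ[ℂ] Qudits F n where
  toFun ψ := WithLp.toLp 2 fun x => ψ (x - a)
  map_add' _ _ := rfl
  map_smul' _ _ := rfl

/-- The operator `Z(b) = Z(b_1) ⊗ ⋯ ⊗ Z(b_n)`, that is, `Z(b)|x⟩ = ω^{tr(b ⬝ x)}|x⟩`, where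
`ω = exp(2πi/p)` and `tr` is the trace from `F` to the prime field. -/
def opZ (b : Fin n → F) : Qudits F n →ₗ[ℂ] Qudits F n where
  toFun ψ := WithLp.toLp 2 fun x =>
    ZMod.stdAddChar (Algebra.trace (ZMod p) F (b ⬝ᵥ x)) * ψ x
  map_add' ψ φ := by
    ext x
    simp [mul_add]
  map_smul' c ψ := by
    ext x
    simp [mul_left_comm]

/-- The error operator `X(a) Z(b)`. -/
def errorOp (a b : Fin n → F) : Qudits F n →ₗ[ℂ] Qudits F n := opX a ∘ₗ opZ p b

/-- The (symplectic) weight of `X(a) Z(b)`: the number of qudits on which it acts nontrivially. -/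
def errorWeight (a b : Fin n → F) : ℕ := {i : Fin n | a i ≠ 0 ∨ b i ≠ 0}.ncard

/-- `Q` carries an `[[n,k,r,d]]_q` subsystem code: `Q` is decomposed as a tensor product
`Q = A ⊗ B` of Hilbert spaces with `dim A = q^k` and `dim B = q^r`, and each error of weight less
than `d` is detected on the subsystem `A`, i.e. compressing it to `Q` gives an operator
`1_A ⊗ G`, where `G` acts on `B` alone. -/
def IsSubsystemCode (Q : Submodule ℂ (Qudits F n)) (k r d : ℕ) : Prop :=
  ∃ Φ : (EuclideanSpace ℂ (Fin (Fintype.card F ^ k)) ⊗[ℂ]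
      EuclideanSpace ℂ (Fin (Fintype.card F ^ r))) ≃ₗᵢ[ℂ] Q,
    ∀ a b : Fin n → F, errorWeight a b < d →
      ∃ G : EuclideanSpace ℂ (Fin (Fintype.card F ^ r)) →ₗ[ℂ]
          EuclideanSpace ℂ (Fin (Fintype.card F ^ r)),
        ∀ w, Q.starProjection (errorOp p a b (Φ w)) =
          Φ (LinearMap.lTensor (EuclideanSpace ℂ (Fin (Fintype.card F ^ k))) G w)

/-- The stabilizer code obtained from a code `C` with `C^⊥ ⊆ C` by the Euclidean (CSS)
construction: the joint `+1`-eigenspace of all `X(a) Z(b)` with `a, b ∈ C^⊥`. -/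
def stabilizerCode (C : Submodule F (Fin n → F)) : Submodule ℂ (Qudits F n) where
  carrier := {ψ | ∀ a ∈ euclideanDual C, ∀ b ∈ euclideanDual C, errorOp p a b ψ = ψ}
  add_mem' := by
    intro ψ φ hψ hφ a ha b hb
    rw [map_add, hψ a ha b hb, hφ a ha b hb]
  zero_mem' := by
    intro a _ b _
    exact map_zero _
  smul_mem' := by
    intro c ψ hψ a ha b hb
    rw [map_smul, hψ a ha b hb]

/-- `Q` is an `[[n,k,r,d]]_q` subsystem BCH code arising from a narrow-sense BCH code of designed
distance `δ`: for some primitive `n`-th root of unity `α`, the narrow-sense BCH code `C` of length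
`n` and designed distance `δ` contains its Euclidean dual, `Q` is the stabilizer code obtained
from `C`, and `Q` has a tensor decomposition that makes it an `[[n,k,r,d]]_q` subsystem code. -/
def IsSubsystemBCHCode (δ : ℕ) (Q : Submodule ℂ (Qudits F n)) (k r d : ℕ) : Prop :=
  ∃ α : AlgebraicClosure F, IsPrimitiveRoot α n ∧
    euclideanDual (bchCode n δ α) ≤ bchCode n δ α ∧
    Q = stabilizerCode p (bchCode n δ α) ∧
    IsSubsystemCode p Q k r d

end Quantum

/-- `δ_max = n / (q^m - 1) * (q^⌈m/2⌉ - 1 - (q - 2) [m odd])`. -/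
def deltaMax (q m n : ℕ) : ℚ :=
  (n : ℚ) / ((q : ℚ) ^ m - 1) *
    ((q : ℚ) ^ ((m + 1) / 2) - 1 - ((q : ℚ) - 2) * (if Odd m then 1 else 0))

end SubsystemBCH

end

namespace SubsystemBCH

open Polynomial

/-! ### Arithmetic of cyclotomic cosets -/

/-! The bound on `δ` enters through one inequality, `x + y * q ^ j < n` for `x, y < δ` and `j ≤ m /
2`. Since `q ^ m ≡ 1` modulo `n`, exponents `j > m / 2` can be traded for `m - j`, so the inequality
controls whole cyclotomic cosets. The cosets of the `x < δ` prime to divisibility by `q` are full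
and disjoint, which gives the dimension (`finrank_bchCode`), and no coset of such exponents meets
the negative of another, which gives `C^⊥ ⊆ C` (`euclideanDual_bchCode_le`).

The stabilizer code is the space of functions on `C / C^⊥`. An error `X(a) Z(b)` with `a` or `b`
outside `C` sends it into its orthogonal complement. By the BCH bound, the only error of weight
below `δ` with `a, b ∈ C` is the identity. Hence every error to be detected compresses to `0` or
`1`, and any tensor decomposition of the right dimensions will do; this is why `r` is free. -/

theorem add_mul_pow_lt_of_le_deltaMax {q m n δ : ℕ} (hq : 2 ≤ q) (hm : 0 < m) (hn : 0 < n)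
    (hdvd : n ∣ q ^ m - 1) (hδ' : (δ : ℚ) ≤ deltaMax q m n) {x y j : ℕ}
    (hx : x < δ) (hy : y < δ) (hj : j ≤ m / 2) : x + y * q ^ j < n := by
  obtain ⟨s, hs⟩ := hdvd
  have hqm : 1 < q ^ m := Nat.one_lt_pow hm.ne' (by omega)
  have hs0 : 0 < s := Nat.pos_of_ne_zero (by rintro rfl; omega)
  have hN : (q : ℚ) ^ m - 1 = n * s := by
    have : q ^ m = n * s + 1 := by omega
    have h2 : ((q ^ m : ℕ) : ℚ) = ((n * s + 1 : ℕ) : ℚ) := by rw [this]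
    push_cast at h2
    linarith
  have hnQ : (0 : ℚ) < n := by exact_mod_cast hn
  have hsQ : (1 : ℚ) ≤ s := by exact_mod_cast hs0
  have hqQ : (2 : ℚ) ≤ q := by exact_mod_cast hq
  set B : ℚ := (q : ℚ) ^ ((m + 1) / 2) - 1 - ((q : ℚ) - 2) * (if Odd m then 1 else 0) with hB
  have hδB : s * (δ : ℚ) ≤ B := by
    have h1 : deltaMax q m n = B / s := by
      rw [deltaMax, hN, ← hB]
      field_simp
    rw [h1, le_div_iff₀ (by linarith)] at hδ'
    linarith
  -- Here `s = (q ^ m - 1) / n ≥ 1`, so lowering `δ` by one lowers `s * δ ≤ B` by at least one.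
  have bd : ∀ z : ℕ, z < δ → (s : ℚ) * z ≤ B - 1 := fun z hz => by
    have : (z : ℚ) + 1 ≤ δ := by exact_mod_cast hz
    nlinarith
  have hpow : (q : ℚ) ^ j ≤ (q : ℚ) ^ (m / 2) := pow_le_pow_right₀ (by linarith) hj
  have hpow1 : (1 : ℚ) ≤ (q : ℚ) ^ (m / 2) := one_le_pow₀ (by linarith)
  have hB0 : (0 : ℚ) ≤ B - 1 := le_trans (by positivity) (bd x hx)
  have hsum : (s : ℚ) * (x + y * (q : ℚ) ^ j) ≤ (B - 1) * (1 + (q : ℚ) ^ (m / 2)) := by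
    have h1 : (s : ℚ) * y * (q : ℚ) ^ j ≤ (B - 1) * (q : ℚ) ^ (m / 2) :=
      mul_le_mul (bd y hy) hpow (by positivity) hB0
    linarith [bd x hx]
  have hlt : (B - 1) * (1 + (q : ℚ) ^ (m / 2)) < s * n := by
    rw [mul_comm, mul_comm (s : ℚ), ← hN]
    -- The left side is `(q^t - 2)(q^t + 1)` for `m = 2t` and `q(q^t - 1)(q^t + 1) = q^m - q` for `m
    -- = 2t + 1`; both are below `q^m - 1`. The correction `q - 2` makes the odd case factor.
    rcases Nat.even_or_odd' m with ⟨t, rfl | rfl⟩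
    · have h1 : (2 * t + 1) / 2 = t := by omega
      have h2 : 2 * t / 2 = t := by omega
      have h3 : ¬ Odd (2 * t) := by simp
      rw [h1, if_neg h3] at hB
      rw [h2, pow_mul', hB]
      rw [h2] at hpow1
      nlinarith
    · have h1 : (2 * t + 1 + 1) / 2 = t + 1 := by omega
      have h2 : (2 * t + 1) / 2 = t := by omega
      have h3 : Odd (2 * t + 1) := by simp
      rw [h1, if_pos h3, pow_succ] at hB
      rw [h2, pow_succ, pow_mul', hB]
      nlinarith
  have : (s : ℚ) * ((x + y * q ^ j : ℕ) : ℚ) < s * n := by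
    push_cast
    linarith
  exact_mod_cast lt_of_mul_lt_mul_left this (by linarith)

section Cosets

variable {q m n δ : ℕ}

theorem not_dvd_add_mul_pow (hone : q ^ m ≡ 1 [MOD n])
    (hlt : ∀ x y j, x < δ → y < δ → j ≤ m / 2 → x + y * q ^ j < n) {x y j : ℕ}
    (hx : x < δ) (hy : y < δ) (hx0 : 0 < x) (hy0 : 0 < y) (hj : j < m) :
    ¬ n ∣ x + y * q ^ j := by
  intro h
  by_cases hj2 : j ≤ m / 2
  · exact (Nat.le_of_dvd (by positivity) h).not_gt (hlt x y j hx hy hj2)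
  -- Multiplying by `q ^ (m - j)` exchanges `x` and `y` and makes the exponent at most `m / 2`.
  · have h1 : n ∣ y + x * q ^ (m - j) := by
      have h2 : n ∣ (x + y * q ^ j) * q ^ (m - j) := h.mul_right _
      rw [← Nat.modEq_zero_iff_dvd] at h2 ⊢
      refine Nat.ModEq.trans ?_ h2
      rw [add_mul, mul_assoc y, ← pow_add, Nat.add_sub_cancel' hj.le, add_comm]
      simpa using (hone.symm.mul_left y).add_left (x * q ^ (m - j))
    exact (Nat.le_of_dvd (by positivity) h1).not_gt (hlt y x (m - j) hy hx (by omega))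

/-- For small `j` both sides are below `n`, so the congruence is an equality, and `q ∤ y` forces `j
= 0`. Taking `x = y` shows that the coset is full; in general, that distinct cosets are disjoint. -/
theorem eq_of_mul_pow_modEq (hone : q ^ m ≡ 1 [MOD n])
    (hlt : ∀ x y j, x < δ → y < δ → j ≤ m / 2 → x + y * q ^ j < n) {x y j : ℕ}
    (hx : x < δ) (hy : y < δ) (hxq : ¬ q ∣ x) (hyq : ¬ q ∣ y) (hj : j < m)
    (h : x * q ^ j ≡ y [MOD n]) : j = 0 ∧ x = y := by
  have key : ∀ x y j, x < δ → y < δ → ¬ q ∣ y → j ≤ m / 2 → x * q ^ j ≡ y [MOD n] →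
      j = 0 ∧ x = y := by
    intro x y j hx hy hyq hj h
    have h1 := hlt y x j hy hx hj
    have h2 : x * q ^ j = y := Nat.ModEq.eq_of_lt_of_lt h (by omega) (by
      have := hlt y x j hy hx hj; omega)
    have hj0 : j = 0 := by
      by_contra hj0
      exact hyq (h2 ▸ (dvd_pow_self q hj0).mul_left x)
    subst hj0
    exact ⟨rfl, by simpa using h2⟩
  by_cases hj2 : j ≤ m / 2
  · exact key x y j hx hy hyq hj2 h
  · have h1 : y * q ^ (m - j) ≡ x [MOD n] := by
      refine (h.symm.mul_right (q ^ (m - j))).trans ?_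
      rw [mul_assoc, ← pow_add, Nat.add_sub_cancel' hj.le]
      simpa using hone.mul_left x
    obtain ⟨h2, -⟩ := key y x (m - j) hy hx hxq (by omega) h1
    omega

theorem card_filter_not_dvd (hq : 0 < q) (hδ : 1 ≤ δ) :
    ((Finset.Ioc 0 (δ - 1)).filter fun x => ¬ q ∣ x).card =
      ⌈((δ : ℚ) - 1) * (1 - 1 / (q : ℚ))⌉₊ := by
  obtain ⟨M, rfl⟩ : ∃ M, δ = M + 1 := ⟨δ - 1, by omega⟩
  have h1 := Finset.card_filter_add_card_filter_not (s := Finset.Ioc 0 M) (fun x => q ∣ x)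
  rw [Nat.Ioc_filter_dvd_card_eq_div, Nat.card_Ioc] at h1
  rw [Nat.add_sub_cancel]
  have hle : M / q ≤ M := Nat.div_le_self _ _
  have hqQ : (0 : ℚ) < q := by exact_mod_cast hq
  have hA : (((M : ℚ) + 1 - 1) * (1 - 1 / (q : ℚ))) = M - M / q := by
    field_simp
    ring
  have hfloor : M / q = ⌊(M : ℚ) / q⌋₊ := by simp [Nat.floor_div_natCast]
  have hlo : ((M / q : ℕ) : ℚ) ≤ M / q := Nat.cast_div_le
  have hhi : (M : ℚ) / q < ((M / q : ℕ) : ℚ) + 1 := by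
    rw [hfloor]; exact Nat.lt_floor_add_one _
  push_cast
  rw [hA]
  have h2 : ((Finset.Ioc 0 M).filter fun x => ¬ q ∣ x).card = M - M / q := by omega
  rw [h2]
  -- `Nat.ceil_eq_iff` needs a nonzero value; zero occurs only for `M = 0` or `q = 1`.
  by_cases hz : M - M / q = 0
  · rw [hz, eq_comm, Nat.ceil_eq_zero]
    have : ((M - M / q : ℕ) : ℚ) = 0 := by rw [hz]; simp
    rw [Nat.cast_sub hle] at this
    have hM : (0:ℚ) ≤ M := by positivity
    rcases Nat.eq_zero_or_pos M with rfl | hMp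
    · simp
    · have hq1 : q ≤ 1 := by
        by_contra hq1
        have := Nat.div_lt_self hMp (by omega : 1 < q)
        omega
      have : q = 1 := by omega
      subst this
      simp
  · rw [eq_comm, Nat.ceil_eq_iff hz]
    constructor
    · rw [Nat.cast_sub (by omega), Nat.cast_sub hle]
      push_cast
      linarith
    · rw [Nat.cast_sub hle]
      linarith

end Cosets

/-! ### Minimal polynomials over finite fields -/

section Minpoly

variable {F : Type*} [Field F] [Fintype F] {L : Type*} [Field L] [Algebra F L]

theorem aeval_pow_card_pow (f : F[X]) (β : L) (j : ℕ) :
    aeval (β ^ Fintype.card F ^ j) f = aeval β f ^ Fintype.card F ^ j := by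
  induction j with
  | zero => simp
  | succ j ih =>
    rw [pow_succ, pow_mul, pow_mul, ← ih, ← map_pow, ← FiniteField.expand_card, expand_aeval]

/-- The degree divides `m` because `β` is a root of `X^(q^m) - X`, while the `m` Frobenius
conjugates of `β` are distinct roots, hence all the roots. -/
theorem natDegree_minpoly_eq {β : L} {m : ℕ} (hm : 0 < m)
    (hβ : β ^ Fintype.card F ^ m = β)
    (hinj : ∀ j < m, β ^ Fintype.card F ^ j = β → j = 0) :
    (minpoly F β).natDegree = m ∧
      ∀ γ : L, aeval γ (minpoly F β) = 0 → ∃ j < m, γ = β ^ Fintype.card F ^ j := by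
  classical
  have hcard : 1 < Fintype.card F := Fintype.one_lt_card
  have haev : aeval β (X ^ Fintype.card F ^ m - X : F[X]) = 0 := by simp [hβ]
  have hne : (X ^ Fintype.card F ^ m - X : F[X]) ≠ 0 :=
    FiniteField.X_pow_card_pow_sub_X_ne_zero _ hm.ne' hcard
  have hint : IsIntegral F β := isAlgebraic_iff_isIntegral.1 ⟨_, hne, haev⟩
  have hirr := minpoly.irreducible hint
  have hle : (minpoly F β).natDegree ≤ m := Nat.le_of_dvd hm
    (hirr.natDegree_dvd_of_dvd_X_pow_card_pow_sub_X
      (by rw [Nat.card_eq_fintype_card]; exact minpoly.dvd F β haev))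
  have hinj' : Set.InjOn (fun j => β ^ Fintype.card F ^ j) (Finset.range m : Set ℕ) := by
    have aux : ∀ i j, i ≤ j → j < m → β ^ Fintype.card F ^ i = β ^ Fintype.card F ^ j → i = j := by
      intro i j hij hj h
      have h1 : β ^ Fintype.card F ^ (m - (j - i)) = β := by
        have h2 := congrArg (· ^ Fintype.card F ^ (m - j)) h
        simp only [← pow_mul, ← pow_add] at h2
        rw [Nat.add_sub_cancel' hj.le, hβ] at h2
        rwa [show m - (j - i) = i + (m - j) by omega]
      by_contra hne
      have := hinj (m - (j - i)) (by omega) h1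
      omega
    intro i hi j hj h
    simp only [Finset.coe_range, Set.mem_Iio] at hi hj
    rcases le_total i j with hij | hij
    · exact aux i j hij hj h
    · exact (aux j i hij hi h.symm).symm
  set S := (Finset.range m).image fun j => β ^ Fintype.card F ^ j with hS
  have hScard : S.card = m := by
    rw [hS, Finset.card_image_of_injOn hinj', Finset.card_range]
  have hmap : (minpoly F β).map (algebraMap F L) ≠ 0 :=
    Polynomial.map_ne_zero (minpoly.ne_zero hint)
  have hsub : S ⊆ ((minpoly F β).map (algebraMap F L)).roots.toFinset := by
    intro γ hγ
    obtain ⟨j, -, rfl⟩ := Finset.mem_image.1 hγ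
    rw [Multiset.mem_toFinset, mem_roots hmap, IsRoot, eval_map_algebraMap, aeval_pow_card_pow,
      minpoly.aeval, zero_pow (by positivity)]
  have hrc : ((minpoly F β).map (algebraMap F L)).roots.toFinset.card ≤ m :=
    (Multiset.toFinset_card_le _).trans ((card_roots' _).trans (by rwa [natDegree_map]))
  have hSeq := Finset.eq_of_subset_of_card_le hsub (by rw [hScard]; exact hrc)
  refine ⟨le_antisymm hle ?_, ?_⟩
  · calc m = S.card := hScard.symm
      _ ≤ _ := Finset.card_le_card hsub
      _ ≤ _ := (Multiset.toFinset_card_le _).trans ((card_roots' _).trans natDegree_map_le)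
  · intro γ hγ
    have : γ ∈ S := by
      rw [hSeq, Multiset.mem_toFinset, mem_roots hmap, IsRoot, eval_map_algebraMap, hγ]
    obtain ⟨j, hj, rfl⟩ := Finset.mem_image.1 this
    exact ⟨j, Finset.mem_range.1 hj, rfl⟩

end Minpoly

/-! ### The Euclidean dual -/

section Dual

variable {F : Type*} [Field F] {n : ℕ}

theorem mem_euclideanDual {C : Submodule F (Fin n → F)} {x : Fin n → F} :
    x ∈ euclideanDual C ↔ ∀ y ∈ C, x ⬝ᵥ y = 0 := Iff.rfl

theorem finrank_euclideanDual (C : Submodule F (Fin n → F)) :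
    Module.finrank F C + Module.finrank F (euclideanDual C) = n := by
  have h : euclideanDual C = C.dualAnnihilator.comap (dotProductEquiv F (Fin n)).toLinearMap := by
    ext x
    simp [mem_euclideanDual, Submodule.mem_dualAnnihilator]
  have h2 : Module.finrank F (euclideanDual C) = Module.finrank F C.dualAnnihilator := by
    rw [h]
    exact (LinearEquiv.ofSubmodule' (dotProductEquiv F (Fin n)) _).finrank_eq
  have := Subspace.finrank_add_finrank_dualAnnihilator_eq C
  rw [h2, this]
  simp

theorem euclideanDual_euclideanDual (C : Submodule F (Fin n → F)) :
    euclideanDual (euclideanDual C) = C := by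
  have hle : C ≤ euclideanDual (euclideanDual C) := fun x hx y hy => by
    rw [dotProduct_comm]; exact hy x hx
  have h1 := finrank_euclideanDual C
  have h2 := finrank_euclideanDual (euclideanDual C)
  exact (Submodule.eq_of_le_of_finrank_eq hle (by omega)).symm

end Dual

/-! ### BCH codes -/

section BCH

variable {F : Type*} [Field F] {n δ : ℕ}

theorem mem_bchCode {α : AlgebraicClosure F} {c : Fin n → F} :
    c ∈ bchCode n δ α ↔ ∀ i : ℕ, 1 ≤ i → i < δ →
      ∑ j : Fin n, algebraMap F (AlgebraicClosure F) (c j) * (α ^ i) ^ (j : ℕ) = 0 := Iff.rfl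

/-- The BCH bound. -/
theorem eq_zero_of_mem_bchCode {α : AlgebraicClosure F} (hα : IsPrimitiveRoot α n)
    {c : Fin n → F} (hc : c ∈ bchCode n δ α) (S : Finset (Fin n)) (hS : S.card < δ)
    (hcS : ∀ j ∉ S, c j = 0) : c = 0 := by
  classical
  have hpoly : ∀ f : (AlgebraicClosure F)[X], f.coeff 0 = 0 → f.natDegree < δ →
      ∑ j : Fin n, algebraMap F (AlgebraicClosure F) (c j) * f.eval (α ^ (j : ℕ)) = 0 := by
    intro f h0 hf
    simp only [eval_eq_sum_range, Finset.mul_sum]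
    rw [Finset.sum_comm]
    refine Finset.sum_eq_zero fun i hi => ?_
    rcases Nat.eq_zero_or_pos i with rfl | hi0
    · simp [h0]
    · have := hc i hi0 (by have := Finset.mem_range.1 hi; omega)
      calc _ = f.coeff i * ∑ j : Fin n, algebraMap F (AlgebraicClosure F) (c j) * (α ^ i) ^ (j : ℕ) := by
            rw [Finset.mul_sum]
            refine Finset.sum_congr rfl fun j _ => ?_
            rw [← pow_mul, ← pow_mul, mul_comm i]
            ring
        _ = 0 := by rw [this, mul_zero]
  funext j
  by_contra hj
  have hjS : j ∈ S := by
    by_contra h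
    exact hj (hcS j h)
  -- This test polynomial isolates the coordinate `j`. The factor `X` removes the constant term,
  -- since the syndromes start at `i = 1`; the degree is still only `S.card < δ`.
  set f : (AlgebraicClosure F)[X] := X * ∏ i ∈ S.erase j, (X - C (α ^ (i : ℕ))) with hf
  have hdeg : f.natDegree ≤ S.card := by
    rw [hf]
    refine natDegree_mul_le.trans ?_
    rw [natDegree_prod_of_monic _ _ fun i _ => monic_X_sub_C _]
    simp only [natDegree_X, natDegree_X_sub_C, Finset.sum_const, smul_eq_mul, mul_one,
      Finset.card_erase_of_mem hjS]
    have := Finset.card_pos.2 ⟨j, hjS⟩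
    omega
  have h := hpoly f (by simp [hf]) (by omega)
  rw [Finset.sum_eq_single j] at h
  · have hjn := j.2
    have hα0 : α ≠ 0 := hα.ne_zero (by omega)
    refine mul_ne_zero ?_ ?_ h
    · simpa using hj
    · rw [hf, eval_mul, eval_prod, eval_X]
      refine mul_ne_zero (pow_ne_zero _ hα0) (Finset.prod_ne_zero_iff.2 fun i hi => ?_)
      rw [eval_sub, eval_X, eval_C, sub_ne_zero]
      intro h2
      exact (Finset.mem_erase.1 hi).1 (Fin.ext (hα.pow_inj i.2 j.2 h2.symm))
  · intro i _ hij
    by_cases hiS : i ∈ S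
    · have : f.eval (α ^ (i : ℕ)) = 0 := by
        rw [hf, eval_mul, eval_prod,
          Finset.prod_eq_zero (Finset.mem_erase.2 ⟨hij, hiS⟩) (by simp), mul_zero]
      rw [this, mul_zero]
    · rw [hcS i hiS, map_zero, zero_mul]
  · simp

theorem sum_mul_pow_eq_aeval {L : Type*} [Field L] [Algebra F L] (c : Fin n → F) (β : L) :
    ∑ j : Fin n, algebraMap F L (c j) * β ^ (j : ℕ) =
      aeval β ((degreeLTEquiv F n).symm c : F[X]) := by
  simp [degreeLTEquiv, map_sum, aeval_monomial]

/-- `C` is the kernel of reduction from polynomials of degree below `n` to `F[X] / (g)`, which is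
onto because remainders have degree below `g.natDegree ≤ n`. -/
theorem finrank_ker_degreeLT_mod {g : F[X]} (hg : g.Monic) (hgn : g.natDegree ≤ n)
    (C : Submodule F (Fin n → F))
    (hC : ∀ c, c ∈ C ↔ g ∣ ((degreeLTEquiv F n).symm c : F[X])) :
    Module.finrank F C + g.natDegree = n := by
  let φ : (Fin n → F) →ₗ[F] AdjoinRoot g :=
    (AdjoinRoot.mkₐ g).toLinearMap ∘ₗ (degreeLT F n).subtype ∘ₗ
      (degreeLTEquiv F n).symm.toLinearMap
  have hker : LinearMap.ker φ = C := by
    ext c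
    rw [hC, LinearMap.mem_ker]
    exact AdjoinRoot.mk_eq_zero
  have hsurj : LinearMap.range φ = ⊤ := by
    rw [LinearMap.range_eq_top]
    intro z
    obtain ⟨f, rfl⟩ := AdjoinRoot.mk_surjective z
    have hmem : f %ₘ g ∈ degreeLT F n := by
      rw [mem_degreeLT]
      refine (degree_modByMonic_lt f hg).trans_le ?_
      rw [degree_eq_natDegree hg.ne_zero]
      exact_mod_cast hgn
    refine ⟨degreeLTEquiv F n ⟨_, hmem⟩, ?_⟩
    change AdjoinRoot.mk g (((degreeLTEquiv F n).symm (degreeLTEquiv F n ⟨_, hmem⟩)) : F[X]) = _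
    rw [LinearEquiv.symm_apply_apply, AdjoinRoot.mk_eq_mk]
    refine ⟨-(f /ₘ g), ?_⟩
    have := modByMonic_add_div f g
    simp only
    linear_combination this
  have h1 := φ.finrank_range_add_finrank_ker
  rw [hker, hsurj, finrank_top, Module.finrank_fin_fun] at h1
  have h2 : Module.finrank F (AdjoinRoot g) = g.natDegree := by
    rw [(AdjoinRoot.powerBasis' hg).finrank, AdjoinRoot.powerBasis'_dim]
  omega

end BCH

/-! ### Dimension and dual of BCH codes -/

section BCH

variable {F : Type*} [Field F] [Fintype F] {m n δ : ℕ}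

theorem natDegree_minpoly_pow {α : AlgebraicClosure F} (hα : IsPrimitiveRoot α n) (hm : 0 < m)
    (hone : Fintype.card F ^ m ≡ 1 [MOD n])
    (hlt : ∀ x y j, x < δ → y < δ → j ≤ m / 2 → x + y * Fintype.card F ^ j < n) {x : ℕ}
    (hx : x < δ) (hxq : ¬ Fintype.card F ∣ x) :
    (minpoly F (α ^ x)).natDegree = m ∧ ∀ y < δ, ¬ Fintype.card F ∣ y →
      aeval (α ^ y) (minpoly F (α ^ x)) = 0 → x = y := by
  have hpow : ∀ {a b : ℕ}, α ^ a = α ^ b ↔ a ≡ b [MOD n] := by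
    intro a b
    have hn : n ≠ 0 := by
      have := hlt x x 0 hx hx (Nat.zero_le _)
      omega
    rw [(hα.isOfFinOrder hn).pow_eq_pow_iff_modEq, ← hα.eq_orderOf]
  obtain ⟨h1, h2⟩ := natDegree_minpoly_eq (F := F) (β := α ^ x) hm
    (by rw [← pow_mul, hpow]; simpa using hone.mul_left x)
    (fun j hj h => by
      rw [← pow_mul, hpow] at h
      exact (eq_of_mul_pow_modEq hone hlt hx hx hxq hxq hj h).1)
  refine ⟨h1, fun y hy hyq h => ?_⟩
  obtain ⟨j, hj, h3⟩ := h2 _ h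
  rw [← pow_mul, hpow] at h3
  exact (eq_of_mul_pow_modEq hone hlt hx hy hxq hyq hj h3.symm).2

theorem finrank_bchCode {α : AlgebraicClosure F} (hα : IsPrimitiveRoot α n) (hn : 0 < n)
    (hm : 0 < m) (hone : Fintype.card F ^ m ≡ 1 [MOD n])
    (hlt : ∀ x y j, x < δ → y < δ → j ≤ m / 2 → x + y * Fintype.card F ^ j < n) :
    Module.finrank F (bchCode n δ α) +
      m * ((Finset.Ioc 0 (δ - 1)).filter fun x => ¬ Fintype.card F ∣ x).card = n := by
  set R := (Finset.Ioc 0 (δ - 1)).filter fun x => ¬ Fintype.card F ∣ x with hR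
  have hRmem : ∀ x ∈ R, 0 < x ∧ x < δ ∧ ¬ Fintype.card F ∣ x := by
    intro x hx
    simp only [hR, Finset.mem_filter, Finset.mem_Ioc] at hx
    exact ⟨hx.1.1, by omega, hx.2⟩
  have hint : ∀ x : ℕ, IsIntegral F (α ^ x) := fun x => Algebra.IsIntegral.isIntegral _
  set g : F[X] := ∏ x ∈ R, minpoly F (α ^ x) with hg
  have hgdvd : ∀ f : F[X], g ∣ f ↔ ∀ x ∈ R, aeval (α ^ x) f = 0 := by
    intro f
    constructor
    · intro h x hx
      exact (minpoly.dvd_iff).1 ((Finset.dvd_prod_of_mem _ hx).trans h)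
    · intro h
      refine Finset.prod_dvd_of_coprime (fun x hx y hy hxy => ?_) fun x hx => minpoly.dvd F _ (h x hx)
      refine ((minpoly.irreducible (hint x)).coprime_iff_not_dvd).2 fun hd => hxy ?_
      obtain ⟨-, hx1, hx2⟩ := hRmem x hx
      obtain ⟨-, hy1, hy2⟩ := hRmem y hy
      exact ((natDegree_minpoly_pow hα hm hone hlt hy1 hy2).2 x hx1 hx2
        (minpoly.dvd_iff.1 hd)).symm
  have hmonic : g.Monic := monic_prod_of_monic _ _ fun x _ => minpoly.monic (hint x)
  have hdeg : g.natDegree = m * R.card := by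
    rw [hg, natDegree_prod_of_monic _ _ fun x _ => minpoly.monic (hint x),
      Finset.sum_congr rfl fun x hx =>
        (natDegree_minpoly_pow hα hm hone hlt (hRmem x hx).2.1 (hRmem x hx).2.2).1]
    simp [mul_comm]
  have hgn : g.natDegree ≤ n := by
    have h1 : g ∣ X ^ n - 1 := (hgdvd _).2 fun x _ => by
      rw [map_sub, map_pow, aeval_X, map_one, ← pow_mul, mul_comm, pow_mul, hα.pow_eq_one,
        one_pow, sub_self]
    have h2 := natDegree_le_of_dvd h1 (X_pow_sub_C_ne_zero hn (1 : F))
    rwa [← C_1, natDegree_X_pow_sub_C] at h2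
  rw [← hdeg]
  refine finrank_ker_degreeLT_mod hmonic hgn _ fun c => ?_
  rw [hgdvd, mem_bchCode]
  simp only [sum_mul_pow_eq_aeval]
  constructor
  · intro h x hx
    exact h x (hRmem x hx).1 (hRmem x hx).2.1
  · intro h i hi hiδ
    -- Frobenius carries the zero at `α ^ x` to `α ^ (q ^ k * x)`, so exponents divisible by `q`
    -- impose no new condition.
    obtain ⟨k, x, hx, rfl⟩ := Nat.exists_eq_pow_mul_and_not_dvd (n := i) (by omega)
      (Fintype.card F) Fintype.one_lt_card.ne'
    have hx0 : 0 < x := Nat.pos_of_ne_zero (by rintro rfl; exact hx (dvd_zero _))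
    have hle : x ≤ Fintype.card F ^ k * x :=
      Nat.le_mul_of_pos_left _ (pow_pos Fintype.card_pos _)
    rw [mul_comm, pow_mul, aeval_pow_card_pow, h x, zero_pow]
    · exact pow_ne_zero _ Fintype.card_ne_zero
    · simp only [hR, Finset.mem_filter, Finset.mem_Ioc]
      exact ⟨⟨hx0, by omega⟩, hx⟩

/-- With `K = F(α)`, the trace words `j ↦ Tr(μ α^(ij))` lie in `C`: their syndromes are combinations
of geometric sums of `n`-th roots of unity different from `1`. A dual word `c` is orthogonal to
them, so `Tr(μ c(α^i)) = 0` for all `μ`, and nondegeneracy of the trace form gives `c(α^i) = 0`. -/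
theorem euclideanDual_bchCode_le {α : AlgebraicClosure F} (hα : IsPrimitiveRoot α n)
    (hm : 0 < m) (hδ : 2 ≤ δ) (hone : Fintype.card F ^ m ≡ 1 [MOD n])
    (hlt : ∀ x y j, x < δ → y < δ → j ≤ m / 2 → x + y * Fintype.card F ^ j < n) :
    euclideanDual (bchCode n δ α) ≤ bchCode n δ α := by
  classical
  have hint : IsIntegral F α := Algebra.IsIntegral.isIntegral _
  let K := IntermediateField.adjoin F {α}
  have hfin : FiniteDimensional F K := IntermediateField.adjoin.finiteDimensional hint
  have hKfin : Finite K := Module.finite_of_finite F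
  have hrank : Module.finrank F K = m := by
    have h1 := (natDegree_minpoly_pow hα hm hone hlt (x := 1) (by omega)
      (by simpa using Fintype.one_lt_card.ne')).1
    rw [pow_one] at h1
    rw [← h1]
    exact IntermediateField.adjoin.finrank hint
  let a : K := IntermediateField.AdjoinSimple.gen F α
  have ha : algebraMap K (AlgebraicClosure F) a = α :=
    IntermediateField.AdjoinSimple.algebraMap_gen F α
  intro c hc i hi hiδ
  have hword : ∀ μ : K, (fun j : Fin n => Algebra.trace F K (μ * (a ^ i) ^ (j : ℕ))) ∈
      bchCode n δ α := by
    intro μ y hy hyδ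
    have hterm : ∀ j : Fin n, algebraMap F (AlgebraicClosure F)
        (Algebra.trace F K (μ * (a ^ i) ^ (j : ℕ))) * (α ^ y) ^ (j : ℕ) =
        ∑ l ∈ Finset.range m, algebraMap K (AlgebraicClosure F) μ ^ Fintype.card F ^ l *
          (α ^ (y + i * Fintype.card F ^ l)) ^ (j : ℕ) := by
      intro j
      rw [IsScalarTower.algebraMap_apply F K (AlgebraicClosure F),
        FiniteField.algebraMap_trace_eq_sum_pow, hrank, Nat.card_eq_fintype_card, map_sum,
        Finset.sum_mul]
      refine Finset.sum_congr rfl fun l _ => ?_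
      rw [map_pow, map_mul, map_pow, map_pow, ha, mul_pow, mul_assoc]
      congr 1
      simp only [← pow_mul, ← pow_add]
      congr 1
      ring
    simp only [hterm]
    rw [Finset.sum_comm]
    refine Finset.sum_eq_zero fun l hl => ?_
    rw [← Finset.mul_sum]
    have hζ : α ^ (y + i * Fintype.card F ^ l) ≠ 1 := fun h =>
      not_dvd_add_mul_pow hone hlt hyδ hiδ hy hi (Finset.mem_range.1 hl)
        ((hα.pow_eq_one_iff_dvd _).1 h)
    rw [Fin.sum_univ_eq_sum_range fun j => (α ^ (y + i * Fintype.card F ^ l)) ^ j,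
      geom_sum_eq hζ, ← pow_mul, mul_comm _ n, pow_mul, hα.pow_eq_one]
    simp
  have hs : ∑ j : Fin n, algebraMap F K (c j) * (a ^ i) ^ (j : ℕ) = 0 := by
    refine (traceForm_nondegenerate F K).1 _ fun μ => ?_
    have h := hc _ (hword μ)
    rw [Algebra.traceForm_apply, Finset.sum_mul, map_sum, ← h, dotProduct]
    refine Finset.sum_congr rfl fun j _ => ?_
    rw [← Algebra.smul_def, smul_mul_assoc, map_smul, smul_eq_mul, mul_comm μ]
  have h := congrArg (algebraMap K (AlgebraicClosure F)) hs
  rw [map_sum, map_zero] at h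
  rw [← h]
  refine Finset.sum_congr rfl fun j _ => ?_
  rw [map_mul, map_pow, map_pow, ha, ← IsScalarTower.algebraMap_apply]

end BCH

/-! ### Stabilizer codes -/

section Quantum

variable {p : ℕ} [Fact p.Prime] {F : Type*} [Field F] [Fintype F] [Algebra (ZMod p) F] {n : ℕ}

theorem errorOp_apply (a b : Fin n → F) (ψ : Qudits F n) (x : Fin n → F) :
    errorOp p a b ψ x =
      ZMod.stdAddChar (Algebra.trace (ZMod p) F (b ⬝ᵥ (x - a))) * ψ (x - a) := rfl

theorem mem_stabilizerCode {C : Submodule F (Fin n → F)} {ψ : Qudits F n} :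
    ψ ∈ stabilizerCode p C ↔
      ∀ a ∈ euclideanDual C, ∀ b ∈ euclideanDual C, errorOp p a b ψ = ψ := Iff.rfl

/-- By biduality some `b ∈ C^⊥` has `b ⬝ᵥ x ≠ 0`; a scalar multiple of `b` then makes the trace
nonzero. -/
theorem exists_trace_ne_zero {C : Submodule F (Fin n → F)} {x : Fin n → F}
    (hx : x ∉ C) :
    ∃ b ∈ euclideanDual C,
      (ZMod.stdAddChar (Algebra.trace (ZMod p) F (b ⬝ᵥ x)) : ℂ) ≠ 1 := by
  rw [← euclideanDual_euclideanDual C, mem_euclideanDual] at hx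
  push Not at hx
  obtain ⟨b, hb, hbx⟩ := hx
  rw [dotProduct_comm] at hbx
  have : CharP F p := charP_of_injective_algebraMap (algebraMap (ZMod p) F).injective p
  have := Module.finite_of_finite (R := ZMod p) (M := F)
  have hnd := (traceForm_nondegenerate (ZMod p) F).1 (b ⬝ᵥ x)
  by_contra! hcon
  refine hbx (hnd fun t => ?_)
  have h := hcon (t • b) (Submodule.smul_mem _ t hb)
  rw [← AddChar.map_zero_eq_one (ZMod.stdAddChar (N := p)),
    ZMod.injective_stdAddChar.eq_iff, smul_dotProduct, smul_eq_mul, mul_comm] at h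
  exact h

/-- Invariance under the `Z(b)` forces support in `C`; invariance under the `X(a)` forces
periodicity under `C^⊥`. -/
theorem mem_stabilizerCode_iff {C : Submodule F (Fin n → F)} {ψ : Qudits F n} :
    ψ ∈ stabilizerCode p C ↔
      (∀ x ∉ C, ψ x = 0) ∧ ∀ x, ∀ a ∈ euclideanDual C, ψ (x - a) = ψ x := by
  rw [mem_stabilizerCode]
  constructor
  · intro h
    constructor
    · intro x hx
      obtain ⟨b, hb, hne⟩ := exists_trace_ne_zero (p := p) hx
      have h1 := congrArg (fun φ : Qudits F n => φ x) (h 0 (zero_mem _) b hb)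
      simp only [errorOp_apply, sub_zero] at h1
      by_contra h0
      exact hne (mul_right_cancel₀ h0 (h1.trans (one_mul _).symm))
    · intro x a ha
      have h1 := congrArg (fun φ : Qudits F n => φ x) (h a ha 0 (zero_mem _))
      simpa [errorOp_apply] using h1
  · rintro ⟨h1, h2⟩ a ha b hb
    ext x
    rw [errorOp_apply]
    by_cases hx : x - a ∈ C
    · rw [hb _ hx, map_zero, AddChar.map_zero_eq_one, one_mul, h2 x a ha]
    · rw [← h2 x a ha, h1 _ hx, mul_zero]

/-- The stabilizer code of `C` consists of the functions on the quotient `C / C^⊥`. -/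
noncomputable def stabilizerCodeEquiv (C : Submodule F (Fin n → F)) (hC : euclideanDual C ≤ C) :
    stabilizerCode p C ≃ₗ[ℂ] (C ⧸ (euclideanDual C).submoduleOf C → ℂ) := by
  classical
  exact
  { toFun := fun ψ z => Quotient.liftOn' z (fun x => (ψ : Qudits F n) (x : Fin n → F)) (by
      intro x y hxy
      have hxy' := (Submodule.quotientRel_def _).1 hxy
      have h := (mem_stabilizerCode_iff.1 ψ.2).2 x (x - y) hxy'
      simpa using h.symm)
    map_add' := fun ψ φ => by
      funext z
      induction z using Quotient.inductionOn'
      rfl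
    map_smul' := fun t ψ => by
      funext z
      induction z using Quotient.inductionOn'
      rfl
    invFun := fun f => ⟨WithLp.toLp 2 fun x =>
        if h : x ∈ C then f (Submodule.Quotient.mk ⟨x, h⟩) else 0, by
      rw [mem_stabilizerCode_iff]
      refine ⟨fun x hx => by simp [hx], fun x a ha => ?_⟩
      have hiff : x - a ∈ C ↔ x ∈ C := by
        rw [sub_eq_add_neg, Submodule.add_mem_iff_left _ (neg_mem (hC ha))]
      by_cases hx : x ∈ C
      · simp only [hx, hiff, dif_pos]
        congr 1
        rw [Submodule.Quotient.eq, Submodule.submoduleOf, Submodule.mem_comap]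
        simpa using ha
      · simp only [hx, hiff, dif_neg, not_false_eq_true]⟩
    left_inv := fun ψ => by
      ext x
      by_cases hx : x ∈ C
      · simp only [hx, dif_pos]
        rfl
      · simp only [hx, dif_neg, not_false_eq_true]
        exact ((mem_stabilizerCode_iff.1 ψ.2).1 x hx).symm
    right_inv := fun f => by
      funext z
      induction z using Quotient.inductionOn' with
      | h x => exact dif_pos x.2 }

theorem finrank_stabilizerCode (C : Submodule F (Fin n → F)) (hC : euclideanDual C ≤ C) :
    Module.finrank ℂ (stabilizerCode p C) =
      Fintype.card F ^ (n - 2 * Module.finrank F (euclideanDual C)) := by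
  classical
  have : Fintype (C ⧸ (euclideanDual C).submoduleOf C) := Fintype.ofFinite _
  rw [(stabilizerCodeEquiv C hC).finrank_eq, Module.finrank_fintype_fun_eq_card,
    Module.card_eq_pow_finrank (K := F)]
  have h1 := ((euclideanDual C).submoduleOf C).finrank_quotient_add_finrank
  have h2 : Module.finrank F ((euclideanDual C).submoduleOf C) =
      Module.finrank F (euclideanDual C) := (Submodule.submoduleOfEquivOfLe hC).finrank_eq
  have h3 := finrank_euclideanDual C
  congr 1
  omega

/-- If `a ∉ C`, the supports, inside `C` and `C + a`, are disjoint. If `b ∉ C`, translating the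
summation variable by a suitable `c ∈ C^⊥` multiplies the inner product by a character value other
than `1`. -/
theorem inner_errorOp_eq_zero {C : Submodule F (Fin n → F)} {a b : Fin n → F}
    (hab : ¬ (a ∈ C ∧ b ∈ C)) {φ ψ : Qudits F n}
    (hφ : φ ∈ stabilizerCode p C) (hψ : ψ ∈ stabilizerCode p C) :
    inner ℂ φ (errorOp p a b ψ) = 0 := by
  rw [mem_stabilizerCode_iff] at hφ hψ
  rw [PiLp.inner_apply]
  by_cases ha : a ∈ C
  · have hb : b ∉ C := fun hb => hab ⟨ha, hb⟩
    obtain ⟨c, hc, hne⟩ := exists_trace_ne_zero (p := p) hb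
    set S := ∑ x, inner ℂ (φ x) (errorOp p a b ψ x) with hS
    have h1 : S = ZMod.stdAddChar (Algebra.trace (ZMod p) F (c ⬝ᵥ b)) * S := by
      nth_rw 1 [hS]
      rw [← Equiv.sum_comp (Equiv.addRight c), hS, Finset.mul_sum]
      refine Finset.sum_congr rfl fun x _ => ?_
      have e1 : φ (x + c) = φ x := by simpa using hφ.2 x (-c) (neg_mem hc)
      have e2 : ψ (x + c - a) = ψ (x - a) := by
        rw [← hψ.2 (x - a) (-c) (neg_mem hc), show x + c - a = x - a - -c by abel]
      have e3 : b ⬝ᵥ (x + c - a) = c ⬝ᵥ b + b ⬝ᵥ (x - a) := by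
        rw [dotProduct_comm c, ← dotProduct_add]
        congr 1
        abel
      simp only [Equiv.coe_addRight, errorOp_apply, e1, e2, e3, map_add,
        AddChar.map_add_eq_mul, RCLike.inner_apply]
      ring
    by_contra h0
    exact hne (mul_right_cancel₀ h0 (h1.symm.trans (one_mul _).symm))
  · refine Finset.sum_eq_zero fun x _ => ?_
    rw [errorOp_apply]
    by_cases hx : x ∈ C
    · rw [hψ.1 (x - a), mul_zero, inner_zero_right]
      intro hxa
      exact ha (by simpa using sub_mem hx hxa)
    · rw [hφ.1 x hx, inner_zero_left]

theorem errorOp_zero (ψ : Qudits F n) : errorOp p 0 0 ψ = ψ := by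
  ext x
  simp [errorOp_apply]

theorem isSubsystemCode_stabilizerCode {C : Submodule F (Fin n → F)} (hC : euclideanDual C ≤ C)
    {k r d : ℕ} (hkr : k + r = n - 2 * Module.finrank F (euclideanDual C))
    (hd : ∀ a b : Fin n → F, errorWeight a b < d → a ∈ C → b ∈ C → a = 0 ∧ b = 0) :
    IsSubsystemCode p (stabilizerCode p C) k r d := by
  have hrank : Module.finrank ℂ (EuclideanSpace ℂ (Fin (Fintype.card F ^ k)) ⊗[ℂ]
      EuclideanSpace ℂ (Fin (Fintype.card F ^ r))) =
      Module.finrank ℂ (stabilizerCode p C) := by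
    rw [finrank_stabilizerCode C hC, Module.finrank_tensorProduct, finrank_euclideanSpace_fin,
      finrank_euclideanSpace_fin, ← pow_add, hkr]
  -- An arbitrary isometry suffices, since `G` is always `1` or `0`.
  let Φ := (stdOrthonormalBasis ℂ (EuclideanSpace ℂ (Fin (Fintype.card F ^ k)) ⊗[ℂ]
      EuclideanSpace ℂ (Fin (Fintype.card F ^ r)))).equiv
      (stdOrthonormalBasis ℂ (stabilizerCode p C)) (finCongr hrank)
  refine ⟨Φ, fun a b hab => ?_⟩
  by_cases h : a ∈ C ∧ b ∈ C
  · obtain ⟨rfl, rfl⟩ := hd a b hab h.1 h.2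
    refine ⟨LinearMap.id, fun w => ?_⟩
    rw [errorOp_zero, Submodule.starProjection_eq_self_iff.2 (Φ w).2, LinearMap.lTensor_id,
      LinearMap.id_apply]
  · refine ⟨0, fun w => ?_⟩
    rw [LinearMap.lTensor_zero, LinearMap.zero_apply, map_zero, ZeroMemClass.coe_zero,
      Submodule.starProjection_apply_eq_zero_iff, Submodule.mem_orthogonal]
    exact fun φ hφ => inner_errorOp_eq_zero h hφ (Φ w).2

end Quantum

/-! ### Existence of `α`, the distance bound, and the main theorem -/

theorem exists_isPrimitiveRoot_algebraicClosure {F : Type*} [Field F] [Fintype F] {n : ℕ}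
    (h : Nat.Coprime n (Fintype.card F)) : ∃ α : AlgebraicClosure F, IsPrimitiveRoot α n := by
  have : NeZero (n : F) := ⟨fun h0 => by
    obtain ⟨u, v, huv⟩ := Nat.isCoprime_iff_coprime.2 h
    have h1 := congrArg (Int.cast : ℤ → F) huv
    simp [h0] at h1⟩
  exact HasEnoughRootsOfUnity.exists_primitiveRoot _ n

theorem eq_zero_of_ncard_lt {F : Type*} [Field F] {n δ : ℕ} {α : AlgebraicClosure F}
    (hα : IsPrimitiveRoot α n) {c : Fin n → F} (hc : c ∈ bchCode n δ α) {S : Set (Fin n)}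
    (hS : S.ncard < δ) (hcS : ∀ j, c j ≠ 0 → j ∈ S) : c = 0 := by
  classical
  refine eq_zero_of_mem_bchCode hα hc S.toFinset (by rwa [← Set.ncard_eq_toFinset_card']) ?_
  intro j hj
  by_contra h
  exact hj (Set.mem_toFinset.2 (hcS j h))

end SubsystemBCH

theorem mainTheorem5 (p : ℕ) [Fact p.Prime] (F : Type*) [Field F] [Fintype F]
    [Algebra (ZMod p) F] (q m n δ r : ℕ) (hq : Fintype.card F = q)
    (hnq : Nat.Coprime n q) (hm : orderOf (q : ZMod n) = m)
    (hn : q ^ (m / 2) < n) (hn' : n ≤ q ^ m - 1)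
    (hδ : 2 ≤ δ) (hδ' : (δ : ℚ) ≤ SubsystemBCH.deltaMax q m n)
    (hr : r < n - 2 * m * ⌈((δ : ℚ) - 1) * (1 - 1 / (q : ℚ))⌉₊) :
    ∃ (Q : Submodule ℂ (SubsystemBCH.Qudits F n)) (d : ℕ), δ ≤ d ∧
      SubsystemBCH.IsSubsystemBCHCode p δ Q
        (n - 2 * m * ⌈((δ : ℚ) - 1) * (1 - 1 / (q : ℚ))⌉₊ - r) r d := by
  open SubsystemBCH in
  subst hq
  have hn0 : 0 < n := by omega
  -- The default value `m = 0` of `orderOf` would give `n ≤ q ^ 0 - 1 = 0`.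
  have hm0 : 0 < m := Nat.pos_of_ne_zero (by rintro rfl; simp at hn'; omega)
  have hone : Fintype.card F ^ m ≡ 1 [MOD n] := by
    rw [← ZMod.natCast_eq_natCast_iff, Nat.cast_pow, Nat.cast_one, ← hm, pow_orderOf_eq_one]
  have hdvd : n ∣ Fintype.card F ^ m - 1 :=
    (Nat.modEq_iff_dvd' (Nat.one_le_pow _ _ Fintype.card_pos)).1 hone.symm
  have hlt : ∀ x y j, x < δ → y < δ → j ≤ m / 2 → x + y * Fintype.card F ^ j < n :=
    fun x y j hx hy hj =>
      add_mul_pow_lt_of_le_deltaMax Fintype.one_lt_card hm0 hn0 hdvd hδ' hx hy hj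
  obtain ⟨α, hα⟩ := exists_isPrimitiveRoot_algebraicClosure hnq
  have hdual := euclideanDual_bchCode_le hα hm0 hδ hone hlt
  refine ⟨_, δ, le_rfl, α, hα, hdual, rfl, isSubsystemCode_stabilizerCode hdual ?_ ?_⟩
  · have h1 := finrank_bchCode hα hn0 hm0 hone hlt
    have h2 := finrank_euclideanDual (bchCode n δ α)
    rw [card_filter_not_dvd Fintype.card_pos (by omega)] at h1
    rw [Nat.sub_add_cancel hr.le, mul_assoc]
    omega
  · intro a b hab ha hb
    exact ⟨eq_zero_of_ncard_lt hα ha hab fun j hj => Or.inl hj,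
      eq_zero_of_ncard_lt hα hb hab fun j hj => Or.inr hj⟩
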